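/- For polynomials $a\ne b$ in $\mathbb{F}_2[z]\setminus\mathbb{F}_2$, the $(a,b)$-Thue–Morse sequence is the fixed point $s^\infty(a)=abbabaab\cdots$ of the substitution $s\colon a\mapsto ab,\ b\mapsto ba$. For a sequence $\mathbf{c}=(c_n(z))_{n\ge 0}$ in $\mathbb{F}_2[z]\setminus\mathbb{F}_2$, let $$\mathrm{CF}(\mathbf{c}(z))=\cfrac{1}{c_0(z)+\cfrac{1}{c_1(z)+\cfrac{1}{c_2(z)+\ddots}}}\in\mathbb{F}_2((1/z))$$ be the limit, in the $1/z$-adic topology, of the corresponding finite continued fractions. **Theorem.** Let $(a,b)=(z,\,z^2+z+1)$, let $\mathbf{t}$ be the $(a,b)$-Thue–Morse sequence and $\bar{\mathbf{t}}$ the $(b,a)$-Thue–Morse sequence. The two series $\mathrm{CF}(\mathbf{t}(z))$ and $\mathrm{CF}(\bar{\mathbf{t}}(z))$ in $\mathbb{F}_2((1/z))$ are algebraic of degree $4$ over $\mathbb{F}_2(z)$. Their minimal polynomials (up to division by the leading coefficient $p_4$) are of the form $$p_4(z)y^4+p_3(z)y^3+p_2(z)y^2+p_1(z)y+p_0(z),$$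 where for $\mathrm{CF}(\mathbf{t}(z))$ $$\begin{aligned} p_0&=z^9+z^7+z^6+z^5+z^4+z+1,\\ p_1&=z^{11}+z^{10}+z^8+z^6+z^5+z^3+z^2+z,\\ p_2&=z^{12}+z^{10}+z^2,\\ p_3&=z^{11}+z^{10}+z^8+z^6+z^5+z^3+z^2+z,\\ p_4&=z^{10}+z^9+z^7+z^6+z^5+z^2+z, \end{aligned}$$ and for $\mathrm{CF}(\bar{\mathbf{t}}(z))$ $$\begin{aligned} p_0&=z^9+z^8+z^7+z^6+z^5+z^4+z,\\ p_1&=z^{11}+z^{10}+z^8+z^6+z^5+z^3+z^2+z,\\ p_2&=z^{12}+z^{10}+z^2,\\ p_3&=z^{11}+z^{10}+z^8+z^6+z^5+z^3+z^2+z,\\ p_4&=z^{10}+z^9+z^8+z^7+z^6+z^5+z^2+z+1. \end{aligned}$$ -/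

import Mathlib

open Polynomial Filter Topology

noncomputable section

/-- The substitution `a ↦ ab, b ↦ ba` on words over a two-letter alphabet; the letter `false`
stands for `a`, the letter `true` for `b`. -/
def thueMorseSubst (w : List Bool) : List Bool :=
  w.flatMap fun x => if x = false then [false, true] else [true, false]

/-- The word `sⁿ(a)`, which has length `2 ^ n` and is a prefix of `sⁿ⁺¹(a)`. -/
def thueMorseWord (n : ℕ) : List Bool :=
  thueMorseSubst^[n] [false]

/-- The `(a, b)`-Thue–Morse sequence: the fixed point `s^∞(a) = lim sⁿ(a)` of the substitution
`s : a ↦ ab, b ↦ ba`. Its `n`-th letter is the `n`-th letter of `sⁿ(a)` (note `n < 2 ^ n`). -/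
def thueMorse {α : Type*} (a b : α) (n : ℕ) : α :=
  if (thueMorseWord n).getD n false = false then a else b

/-- The formal continued fraction `1/(c 0 + 1/(c 1 + 1/(c 2 + ⋯)))`. -/
def contFrac {L : Type*} [Field L] (c : ℕ → L) : GenContFract L where
  h := 0
  s := ⟨fun n => some ⟨1, c n⟩, fun h => by simp at h⟩

open Classical in
/-- The field `K((1/z))`, the completion of `K(z)` at the place `z = ∞`. -/
abbrev LaurentAtInfty (K : Type*) [Field K] : Type _ :=
  RatFunc.CompletionAtInfty K

/-- `f` is the value `CF(c)` in `K((1/z))` of the infinite continued fraction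
`1/(c₀(z) + 1/(c₁(z) + ⋯))`: the limit of the finite continued fractions. -/
def IsContFracValue {K : Type*} [Field K] (c : ℕ → K[X]) (f : LaurentAtInfty K) : Prop :=
  Tendsto
    (fun n => (contFrac fun j =>
      algebraMap (RatFunc K) (LaurentAtInfty K) (algebraMap K[X] (RatFunc K) (c j))).convs' n)
    atTop (𝓝 f)

/-- The polynomial `p₄ y⁴ + p₃ y³ + p₂ y² + p₁ y + p₀` in `y` over `K(z)`,
for `p₀, …, p₄ ∈ K[z]`. -/
def quartic {K : Type*} [Field K] (p₀ p₁ p₂ p₃ p₄ : K[X]) : (RatFunc K)[X] :=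
  (C p₄ * X ^ 4 + C p₃ * X ^ 3 + C p₂ * X ^ 2 + C p₁ * X + C p₀ : K[X][X]).map
    (algebraMap K[X] (RatFunc K))

end

/-! Write `τ = ab + a + b`, `π = ab`, and let `M` be the continuant matrix of the first `4 ^ (k +
1)` terms. The Thue–Morse word of that length is `uvvu` with `v` the complement of `u`, so `M = P
Pᵀ` for a matrix `P`. In characteristic two the first entry and the trace are then squares `α²` and
`τₖ²`, and determinant one forces the off-diagonal entry `1 + α² + ατₖ`. Along these convergents `f`
is therefore the limit of `1 + τₖ/α`.

The recurrences (`symMatrix_mul`, `thueMorseRoots_two_mul`) give `τₖ₊₁ = (π/τ) τₖ⁴` and express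
`α/τₖ` through the sums of the `1/τⱼ`. Raising to the fourth power is additive, so the limit `U` of
these sums satisfies a quartic: `y = τU` has `y⁴ = πτ²(y + 1)`, and `u = 1/(1 + f)` is a quadratic
polynomial in `y`.

Eisenstein at `z` makes the quartic of `y` irreducible. Since `f` and `y` generate the same field,
`f` has degree 4, and any nonzero quartic killing `f` is a constant multiple of its minimal
polynomial. Eliminating `y` produces that quartic. -/

/-! ### Topology of the completion at infinity. -/

open Classical in
theorem valued_laurentAtInfty_algebraMap {K : Type*} [Field K] {p : K[X]} (hp : p ≠ 0) :
    Valued.v (algebraMap (RatFunc K) (LaurentAtInfty K) (algebraMap K[X] (RatFunc K) p)) =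
      WithZero.exp (p.natDegree : ℤ) := by
  rw [← RatFunc.inftyValuation.polynomial K hp]
  exact @Valued.valuedCompletion_apply (RatFunc K) _ _ _ (RatFunc.inftyValued K) _

open Classical in
instance {K : Type*} [Field K] : CompleteSpace (LaurentAtInfty K) :=
  letI := (RatFunc.inftyValued K).toUniformSpace
  inferInstanceAs (CompleteSpace (UniformSpace.Completion (RatFunc K)))

theorem Valued.nonarchimedeanRing {R Γ₀ : Type*} [Ring R] [LinearOrderedCommGroupWithZero Γ₀]
    [hv : Valued R Γ₀] : NonarchimedeanRing R where
  is_nonarchimedean U hU := by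
    obtain ⟨γ, hγ⟩ := Valued.mem_nhds_zero.mp hU
    refine ⟨⟨hv.v.restrict.ltAddSubgroup γ, ?_⟩, hγ⟩
    exact Valued.isOpen_ball R γ.1

open Classical in
theorem exists_tendsto_of_tendsto_sub_zero {K : Type*} [Field K] {u : ℕ → LaurentAtInfty K}
    (hu : Tendsto (fun n => u (n + 1) - u n) atTop (𝓝 0)) : ∃ x, Tendsto u atTop (𝓝 x) := by
  have : NonarchimedeanRing (LaurentAtInfty K) := Valued.nonarchimedeanRing
  exact cauchySeq_tendsto_of_complete (NonarchimedeanAddGroup.cauchySeq_of_tendsto_sub_nhds_zero hu)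

open Classical in
theorem tendsto_inv_algebraMap_zero {K : Type*} [Field K] {p : ℕ → K[X]}
    (hp : Tendsto (fun n => (p n).natDegree) atTop atTop) :
    Tendsto (fun n => (algebraMap (RatFunc K) (LaurentAtInfty K)
      (algebraMap K[X] (RatFunc K) (p n)))⁻¹) atTop (𝓝 0) := by
  rw [tendsto_def]
  intro s hs
  rw [Valued.mem_nhds_zero] at hs
  obtain ⟨γ, hγ⟩ := hs
  simp only [Valuation.restrict_lt_iff_lt_embedding] at hγ
  set δ := MonoidWithZeroHom.ValueGroup₀.embedding γ.1 with hδ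
  have hδ0 : δ ≠ 0 := by simp [hδ]
  -- The value of the inverse is `exp (-deg)`, below `δ` once the degree exceeds `-log δ`. The `+ 1`
  -- gives strictness and also makes the degree positive, so `p n ≠ 0`.
  have hev := hp.eventually_ge_atTop ((-WithZero.log δ).toNat + 1)
  filter_upwards [hev] with n hn
  apply hγ
  have h0 : p n ≠ 0 := by
    rintro h
    simp [h] at hn
  rw [Set.mem_ofPred_eq, map_inv₀, valued_laurentAtInfty_algebraMap h0, ← WithZero.exp_neg,
    ← WithZero.exp_log hδ0, WithZero.exp_lt_exp]
  omega

/-! ### Continuants and convergence of continued fractions. -/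

/-- The product of the matrices `!![cᵢ, 1; 1, 0]` for `i < n`, whose first column consists of the
denominator and the numerator of the continued fraction `1/(c₀ + 1/(c₁ + ⋯ + 1/cₙ₋₁))`. -/
def contMatrix {R : Type*} [CommRing R] (c : ℕ → R) (n : ℕ) : Matrix (Fin 2) (Fin 2) R :=
  ((List.range n).map fun i => !![c i, 1; 1, 0]).prod

section contMatrix

variable {R : Type*} [CommRing R] (c : ℕ → R) (n : ℕ)

theorem contMatrix_zero : contMatrix c 0 = 1 := by
  simp [contMatrix]

theorem contMatrix_succ : contMatrix c (n + 1) = contMatrix c n * !![c n, 1; 1, 0] := by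
  simp [contMatrix, List.range_succ]

theorem contMatrix_succ' :
    contMatrix c (n + 1) = !![c 0, 1; 1, 0] * contMatrix (fun i => c (i + 1)) n := by
  simp [contMatrix, List.range_succ_eq_map, Function.comp_def]

theorem contMatrix_succ'_zero_zero : contMatrix c (n + 1) 0 0 =
    c 0 * contMatrix (fun i => c (i + 1)) n 0 0 + contMatrix (fun i => c (i + 1)) n 1 0 := by
  simp [contMatrix_succ', Matrix.mul_apply, Fin.sum_univ_two]

theorem contMatrix_succ'_one_zero :
    contMatrix c (n + 1) 1 0 = contMatrix (fun i => c (i + 1)) n 0 0 := by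
  simp [contMatrix_succ', Matrix.mul_apply, Fin.sum_univ_two]

theorem det_contMatrix : (contMatrix c n).det = (-1) ^ n := by
  induction n with
  | zero => simp [contMatrix_zero]
  | succ n ih => simp [contMatrix_succ, ih, pow_succ]

/-- Consecutive convergents differ by `±1` over the product of their denominators; this drives
convergence. -/
theorem contMatrix_cross : contMatrix c (n + 1) 1 0 * contMatrix c n 0 0 -
    contMatrix c n 1 0 * contMatrix c (n + 1) 0 0 = (-1) ^ n := by
  rw [← det_contMatrix c n, Matrix.det_fin_two]
  simp only [contMatrix_succ, Matrix.mul_apply, Fin.sum_univ_two, Matrix.of_apply,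
    Matrix.cons_val', Matrix.cons_val_zero, Matrix.cons_val_one, Matrix.cons_val_fin_one]
  ring

end contMatrix

section degree

variable {K : Type*} [Field K]

/-- The two claims are proved together: the strict inequality prevents cancellation of the leading
term when a partial quotient is prepended. -/
theorem degree_contMatrix (n : ℕ) : ∀ {c : ℕ → K[X]}, (∀ i, 1 ≤ (c i).natDegree) →
    (contMatrix c n 1 0).degree < (contMatrix c n 0 0).degree ∧
      n ≤ (contMatrix c n 0 0).natDegree := by
  induction n with
  | zero => intro c _; simp [contMatrix_zero]
  | succ n ih =>
    intro c hc
    obtain ⟨hlt, hn⟩ := ih (c := fun i => c (i + 1)) fun i => hc _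
    rw [contMatrix_succ'_zero_zero, contMatrix_succ'_one_zero]
    set A := contMatrix (fun i => c (i + 1)) n 0 0
    set B := contMatrix (fun i => c (i + 1)) n 1 0
    have hA : A ≠ 0 := by rintro h; simp [h] at hlt
    have hc0 : c 0 ≠ 0 := by intro h; have := hc 0; simp [h] at this
    have hcA : A.degree < (c 0 * A).degree := by
      rw [degree_eq_natDegree hA, degree_eq_natDegree (mul_ne_zero hc0 hA), natDegree_mul hc0 hA]
      have := hc 0
      exact_mod_cast (by omega : A.natDegree < (c 0).natDegree + A.natDegree)
    have hdeg : (c 0 * A + B).degree = (c 0 * A).degree :=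
      degree_add_eq_left_of_degree_lt (hlt.trans hcA)
    rw [hdeg, natDegree_eq_of_degree_eq hdeg, natDegree_mul hc0 hA]
    exact ⟨hcA, by have := hc 0; omega⟩

theorem contMatrix_zero_zero_ne_zero {c : ℕ → K[X]} (hc : ∀ i, 1 ≤ (c i).natDegree) (n : ℕ) :
    contMatrix c n 0 0 ≠ 0 := by
  intro h
  have := (degree_contMatrix n hc).1
  simp [h] at this

end degree

theorem convs'_contFrac_zero {L : Type*} [Field L] (c : ℕ → L) : (contFrac c).convs' 0 = 0 := by
  simp [contFrac]

theorem convs'_contFrac_succ {L : Type*} [Field L] (c : ℕ → L) (n : ℕ) :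
    (contFrac c).convs' (n + 1) = 1 / (c 0 + (contFrac fun i => c (i + 1)).convs' n) := by
  simp only [GenContFract.convs', contFrac, zero_add]
  rfl

theorem convs'_contFrac_eq_div {K L : Type*} [Field K] [Field L] {ι : K[X] →+* L}
    (hι : Function.Injective ι) (n : ℕ) : ∀ {c : ℕ → K[X]}, (∀ i, 1 ≤ (c i).natDegree) →
    (contFrac fun i => ι (c i)).convs' n = ι (contMatrix c n 1 0) / ι (contMatrix c n 0 0) := by
  induction n with
  | zero => intro c _; rw [convs'_contFrac_zero]; simp [contMatrix_zero]
  | succ n ih =>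
    intro c hc
    have h0 := contMatrix_zero_zero_ne_zero (c := fun i => c (i + 1)) (fun i => hc _) n
    have h1 := contMatrix_zero_zero_ne_zero hc (n + 1)
    rw [convs'_contFrac_succ, ih fun i => hc _, contMatrix_succ'_one_zero]
    rw [contMatrix_succ'_zero_zero] at h1 ⊢
    rw [← map_ne_zero_iff ι hι] at h0 h1
    rw [map_add, map_mul] at h1 ⊢
    field_simp

/-- The embedding of polynomials into the completion at infinity. -/
noncomputable abbrev polyToLaurent (K : Type*) [Field K] : K[X] →+* LaurentAtInfty K :=
  (algebraMap (RatFunc K) (LaurentAtInfty K)).comp (algebraMap K[X] (RatFunc K))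

theorem polyToLaurent_injective (K : Type*) [Field K] : Function.Injective (polyToLaurent K) :=
  (algebraMap (RatFunc K) (LaurentAtInfty K)).injective.comp (RatFunc.algebraMap_injective K)

theorem isContFracValue_iff {K : Type*} [Field K] {c : ℕ → K[X]} (hc : ∀ i, 1 ≤ (c i).natDegree)
    {f : LaurentAtInfty K} : IsContFracValue c f ↔
      Tendsto (fun n => polyToLaurent K (contMatrix c n 1 0) / polyToLaurent K (contMatrix c n 0 0))
        atTop (𝓝 f) := by
  simp only [← convs'_contFrac_eq_div (polyToLaurent_injective K) _ hc]
  rfl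

theorem exists_isContFracValue {K : Type*} [Field K] {c : ℕ → K[X]}
    (hc : ∀ i, 1 ≤ (c i).natDegree) : ∃ f, IsContFracValue c f := by
  simp only [isContFracValue_iff hc]
  apply exists_tendsto_of_tendsto_sub_zero
  -- The inverse written here is the difference of consecutive convergents, with the sign absorbed
  -- into the denominator.
  have key : Tendsto (fun n => (polyToLaurent K
      ((-1) ^ n * (contMatrix c (n + 1) 0 0 * contMatrix c n 0 0)))⁻¹) atTop (𝓝 0) := by
    apply tendsto_inv_algebraMap_zero
    refine tendsto_atTop_mono (fun n => ?_) tendsto_id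
    have h1 := contMatrix_zero_zero_ne_zero hc (n + 1)
    have h0 := contMatrix_zero_zero_ne_zero hc n
    rw [natDegree_mul (by simp) (mul_ne_zero h1 h0), natDegree_mul h1 h0]
    have := (degree_contMatrix n hc).2
    simp only [id]
    omega
  refine key.congr fun n => ?_
  have h1 := contMatrix_zero_zero_ne_zero hc (n + 1)
  have h0 := contMatrix_zero_zero_ne_zero hc n
  rw [← map_ne_zero_iff _ (polyToLaurent_injective K)] at h0 h1
  have hcross := congrArg (polyToLaurent K) (contMatrix_cross c n)
  rw [map_sub, map_mul, map_mul] at hcross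
  rw [div_sub_div _ _ h1 h0, mul_comm (polyToLaurent K (contMatrix c (n + 1) 0 0)) (_), hcross]
  rcases neg_one_pow_eq_or K[X] n with h | h <;>
    simp [h, mul_comm, neg_div]

/-! ### Block structure of the Thue–Morse sequence. -/

section word

theorem thueMorseSubst_append (u v : List Bool) :
    thueMorseSubst (u ++ v) = thueMorseSubst u ++ thueMorseSubst v := by
  simp [thueMorseSubst]

theorem iterate_thueMorseSubst_append (n : ℕ) (u v : List Bool) :
    thueMorseSubst^[n] (u ++ v) = thueMorseSubst^[n] u ++ thueMorseSubst^[n] v := by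
  induction n generalizing u v with
  | zero => rfl
  | succ n ih => simp only [Function.iterate_succ_apply, thueMorseSubst_append, ih]

theorem thueMorseSubst_map_not (w : List Bool) :
    thueMorseSubst (w.map not) = (thueMorseSubst w).map not := by
  induction w with
  | nil => rfl
  | cons x w ih =>
    rw [List.map_cons, ← List.singleton_append, thueMorseSubst_append, ih,
      ← List.singleton_append (l := w), thueMorseSubst_append, List.map_append]
    cases x <;> rfl

theorem iterate_thueMorseSubst_map_not (n : ℕ) (w : List Bool) :
    thueMorseSubst^[n] (w.map not) = (thueMorseSubst^[n] w).map not := by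
  induction n generalizing w with
  | zero => rfl
  | succ n ih => simp only [Function.iterate_succ_apply, thueMorseSubst_map_not, ih]

/-- `sⁿ⁺¹(a) = sⁿ(a) sⁿ(b)`, and exchanging the two letters commutes with `s`. -/
theorem thueMorseWord_succ (n : ℕ) :
    thueMorseWord (n + 1) = thueMorseWord n ++ (thueMorseWord n).map not := by
  rw [thueMorseWord, Function.iterate_succ_apply]
  exact (iterate_thueMorseSubst_append n [false] [true]).trans
    (congrArg _ (iterate_thueMorseSubst_map_not n [false]))

theorem length_thueMorseWord (n : ℕ) : (thueMorseWord n).length = 2 ^ n := by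
  induction n with
  | zero => rfl
  | succ n ih => rw [thueMorseWord_succ, List.length_append, List.length_map, ih, pow_succ]; ring

theorem getD_thueMorseWord_add {n i : ℕ} (hi : i < 2 ^ n) (k : ℕ) :
    (thueMorseWord (n + k)).getD i false = (thueMorseWord n).getD i false := by
  induction k with
  | zero => rfl
  | succ k ih =>
    rw [← ih, ← add_assoc, thueMorseWord_succ, List.getD_append]
    rw [length_thueMorseWord]
    exact hi.trans_le (Nat.pow_le_pow_right two_pos (Nat.le_add_right n k))

theorem getD_thueMorseWord {n i : ℕ} (hi : i < 2 ^ n) :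
    (thueMorseWord i).getD i false = (thueMorseWord n).getD i false := by
  rw [← getD_thueMorseWord_add hi i, ← getD_thueMorseWord_add i.lt_two_pow_self n, add_comm]

end word

section sequence

variable {α : Type*} (a b : α)

theorem thueMorse_zero : thueMorse a b 0 = a := rfl

theorem thueMorse_two_pow_add {n i : ℕ} (hi : i < 2 ^ n) :
    thueMorse a b (2 ^ n + i) = thueMorse b a i := by
  have h : 2 ^ n + i < 2 ^ (n + 1) := by rw [pow_succ]; omega
  rw [thueMorse, thueMorse, getD_thueMorseWord h, getD_thueMorseWord hi, thueMorseWord_succ,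
    List.getD_append_right _ _ _ _ (by simp [length_thueMorseWord]), length_thueMorseWord,
    Nat.add_sub_cancel_left, List.getD_eq_getElem _ _ (by simpa [length_thueMorseWord]),
    List.getD_eq_getElem _ _ (by simpa [length_thueMorseWord]), List.getElem_map]
  cases (thueMorseWord n)[i]'(by simpa [length_thueMorseWord]) <;> simp

theorem thueMorse_eq_or (n : ℕ) : thueMorse a b n = a ∨ thueMorse a b n = b := by
  rw [thueMorse]
  exact ite_eq_or_eq _ _ _

end sequence

/-! ### Continuant matrices of Thue–Morse prefixes. -/

section contMatrix

variable {R : Type*} [CommRing R]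

theorem contMatrix_congr {c d : ℕ → R} {n : ℕ} (h : ∀ i < n, c i = d i) :
    contMatrix c n = contMatrix d n := by
  rw [contMatrix, contMatrix]
  congr 1
  exact List.map_congr_left fun i hi => by rw [h i (List.mem_range.mp hi)]

theorem contMatrix_add (c : ℕ → R) (m n : ℕ) :
    contMatrix c (m + n) = contMatrix c m * contMatrix (fun i => c (m + i)) n := by
  induction n with
  | zero => simp [contMatrix_zero]
  | succ n ih => rw [← add_assoc, contMatrix_succ, ih, contMatrix_succ, mul_assoc]

theorem contMatrix_thueMorse_zero (a b : R) :
    contMatrix (thueMorse a b) (2 ^ 0) = !![a, 1; 1, 0] := by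
  simp [contMatrix, thueMorse_zero]

theorem contMatrix_thueMorse_succ (a b : R) (n : ℕ) :
    contMatrix (thueMorse a b) (2 ^ (n + 1)) =
      contMatrix (thueMorse a b) (2 ^ n) * contMatrix (thueMorse b a) (2 ^ n) := by
  rw [pow_succ, mul_two, contMatrix_add]
  congr 1
  exact contMatrix_congr fun i hi => thueMorse_two_pow_add a b hi

end contMatrix

/-- The triple `(α, τ, ε)` such that, in characteristic two, the continuant matrix of the first
`4 ^ (k + 1)` terms of the `(a, b)`-Thue–Morse sequence is
`!![α², 1 + α² + ατ; 1 + α² + ατ, α² + τ²]`, while the first entry of the matrix of the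
`(b, a)`-Thue–Morse sequence is `(α + τ + ε)²`. -/
def thueMorseRoots {R : Type*} [CommRing R] (a b : R) : ℕ → R × R × R
  | 0 => (a * b + a + 1, a * b + a + b, a * b)
  | k + 1 =>
    let (α, τ, ε) := thueMorseRoots a b k
    (α * τ ^ 2 * ε + τ * ε + 1, τ ^ 3 * ε, τ ^ 2 * ε ^ 2)

/-- In characteristic two, the symmetric matrix of determinant one and trace `τ²` whose first
entry is `α²`. -/
def symMatrix {R : Type*} [CommRing R] (α τ : R) : Matrix (Fin 2) (Fin 2) R :=
  !![α ^ 2, 1 + α ^ 2 + α * τ; 1 + α ^ 2 + α * τ, α ^ 2 + τ ^ 2]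

section char_two

variable {R : Type*} [CommRing R] [CharP R 2]

/-- The product is `P Pᵀ` with `P = MN`, both factors being symmetric. In characteristic two its
first entry is the square of the sum of the first row of `P`, and its trace the square of the sum of
all entries. -/
theorem symMatrix_mul (α τ ε : R) :
    symMatrix α τ * symMatrix (α + τ + ε) τ * (symMatrix (α + τ + ε) τ * symMatrix α τ) =
      symMatrix (α * τ ^ 2 * ε + τ * ε + 1) (τ ^ 3 * ε) := by
  have h2 : (2 : R) = 0 := CharTwo.two_eq_zero
  ext i j
  fin_cases i <;> fin_cases j <;>
    simp [symMatrix, Matrix.mul_apply, Fin.sum_univ_two]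
  all_goals grind

theorem symMatrix_mul_base (a b : R) :
    !![a, 1; 1, 0] * !![b, 1; 1, 0] * (!![b, 1; 1, 0] * !![a, 1; 1, 0]) =
      symMatrix (a * b + a + 1) (a * b + a + b) := by
  have h2 : (2 : R) = 0 := CharTwo.two_eq_zero
  ext i j
  fin_cases i <;> fin_cases j <;>
    simp [symMatrix, Matrix.mul_apply, Fin.sum_univ_two]
  all_goals grind

theorem thueMorseRoots_swap (a b : R) (k : ℕ) :
    thueMorseRoots b a k = ((thueMorseRoots a b k).1 + (thueMorseRoots a b k).2.1 +
      (thueMorseRoots a b k).2.2, (thueMorseRoots a b k).2) := by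
  have h2 : (2 : R) = 0 := CharTwo.two_eq_zero
  induction k with
  | zero => simp only [thueMorseRoots]; ext <;> grind
  | succ k ih => simp only [thueMorseRoots, ih]; ext <;> grind

theorem contMatrix_thueMorse_eq_symMatrix (k : ℕ) : ∀ a b : R,
    contMatrix (thueMorse a b) (2 ^ (2 * k + 2)) =
      symMatrix (thueMorseRoots a b k).1 (thueMorseRoots a b k).2.1 := by
  induction k with
  | zero =>
    intro a b
    simp only [Nat.mul_zero, zero_add, contMatrix_thueMorse_succ _ _ 1,
      contMatrix_thueMorse_succ _ _ 0, contMatrix_thueMorse_zero, symMatrix_mul_base]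
    rfl
  | succ k ih =>
    intro a b
    rw [Nat.mul_succ, contMatrix_thueMorse_succ, contMatrix_thueMorse_succ a b,
      contMatrix_thueMorse_succ b a (2 * k + 2), ih, ih, thueMorseRoots_swap a b, symMatrix_mul]
    rfl

end char_two

/-- The ratio `ε/τ` is invariant under the recursion, which turns `τ³ε` into a constant times `τ⁴`.
-/
theorem thueMorseRoots_two_mul {R : Type*} [CommRing R] (a b : R) (k : ℕ) :
    (thueMorseRoots a b k).2.2 * (a * b + a + b) = a * b * (thueMorseRoots a b k).2.1 := by
  induction k with
  | zero => simp only [thueMorseRoots]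
  | succ k ih =>
    simp only [thueMorseRoots]
    linear_combination (thueMorseRoots a b k).2.1 ^ 2 * (thueMorseRoots a b k).2.2 * ih

theorem natDegree_mul_add_add {K : Type*} [Field K] {a b : K[X]} (ha : 1 ≤ a.natDegree)
    (hb : 1 ≤ b.natDegree) : (a * b + a + b).natDegree = a.natDegree + b.natDegree := by
  have ha0 : a ≠ 0 := by rintro rfl; simp at ha
  have hb0 : b ≠ 0 := by rintro rfl; simp at hb
  have hab : (a * b).natDegree = a.natDegree + b.natDegree := natDegree_mul ha0 hb0
  rw [add_assoc, natDegree_add_eq_left_of_natDegree_lt, hab]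
  exact (natDegree_add_le a b).trans_lt (by omega)

theorem le_natDegree_thueMorseRoots {K : Type*} [Field K] {a b : K[X]} (ha : 1 ≤ a.natDegree)
    (hb : 1 ≤ b.natDegree) (k : ℕ) : k + 1 ≤ (thueMorseRoots a b k).2.1.natDegree ∧
      k + 1 ≤ (thueMorseRoots a b k).2.2.natDegree := by
  have ha0 : a ≠ 0 := by rintro rfl; simp at ha
  have hb0 : b ≠ 0 := by rintro rfl; simp at hb
  induction k with
  | zero =>
    simp only [thueMorseRoots]
    rw [natDegree_mul_add_add ha hb, natDegree_mul ha0 hb0]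
    omega
  | succ k ih =>
    obtain ⟨h1, h2⟩ := ih
    have h1' : (thueMorseRoots a b k).2.1 ≠ 0 := by intro h; simp [h] at h1
    have h2' : (thueMorseRoots a b k).2.2 ≠ 0 := by intro h; simp [h] at h2
    simp only [thueMorseRoots]
    rw [natDegree_mul (pow_ne_zero _ h1') h2',
      natDegree_mul (pow_ne_zero _ h1') (pow_ne_zero _ h2')]
    simp only [natDegree_pow]
    omega

theorem one_le_natDegree_thueMorse {K : Type*} [Field K] {a b : K[X]} (ha : 1 ≤ a.natDegree)
    (hb : 1 ≤ b.natDegree) (i : ℕ) :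
    1 ≤ (thueMorse a b i).natDegree := by
  rcases thueMorse_eq_or a b i with h | h <;> rwa [h]

/-! ### Passage to the limit and the quartic equation. -/

section limits

variable {K : Type*} [Field K] [CharP K 2] {a b : K[X]}

instance : CharP (LaurentAtInfty K) 2 :=
  charP_of_injective_ringHom (f := (polyToLaurent K).comp C)
    ((polyToLaurent_injective K).comp C_injective) 2

/-- `α²` is itself a continuant, so its degree is at least the number of terms. -/
theorem le_natDegree_thueMorseRoots_fst_sq (ha : 1 ≤ a.natDegree) (hb : 1 ≤ b.natDegree) (k : ℕ) :
    k ≤ ((thueMorseRoots a b k).1 ^ 2).natDegree := by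
  have h := (degree_contMatrix (2 ^ (2 * k + 2)) (one_le_natDegree_thueMorse ha hb)).2
  rw [contMatrix_thueMorse_eq_symMatrix] at h
  have h2 := (2 * k + 2).lt_two_pow_self
  simp only [symMatrix, Matrix.of_apply, Matrix.cons_val', Matrix.cons_val_zero] at h
  omega

/-- The sums of the inverses of the square roots of the traces converge to a root of a quartic
equation, which determines the value of the Thue–Morse continued fraction. -/
theorem exists_quartic_root_of_isContFracValue (ha : 1 ≤ a.natDegree) (hb : 1 ≤ b.natDegree)
    {f : LaurentAtInfty K} (hf : IsContFracValue (thueMorse a b) f) {τ π A : LaurentAtInfty K}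
    (hτ : τ = polyToLaurent K (a * b + a + b)) (hπ : π = polyToLaurent K (a * b))
    (hA : A = polyToLaurent K (a * b + a + 1)) :
    ∃ y u : LaurentAtInfty K, y ^ 4 = π * τ ^ 2 * (y + 1) ∧
      τ ^ 2 * u = y ^ 2 + τ * y + τ * (A + 1) ∧ u * (1 + f) = 1 := by
  have h2 : (2 : LaurentAtInfty K) = 0 := CharTwo.two_eq_zero
  have hdeg := le_natDegree_thueMorseRoots ha hb
  have hι := polyToLaurent_injective K
  obtain ⟨t, ht⟩ : ∃ t : ℕ → LaurentAtInfty K,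
    t = fun k => polyToLaurent K (thueMorseRoots a b k).2.1 := ⟨_, rfl⟩
  obtain ⟨e, he⟩ : ∃ e : ℕ → LaurentAtInfty K,
    e = fun k => polyToLaurent K (thueMorseRoots a b k).2.2 := ⟨_, rfl⟩
  obtain ⟨α, hα⟩ : ∃ α : ℕ → LaurentAtInfty K,
    α = fun k => polyToLaurent K (thueMorseRoots a b k).1 := ⟨_, rfl⟩
  have ht0 : ∀ k, t k ≠ 0 := fun k => by
    rw [ht, map_ne_zero_iff _ hι]
    intro h
    have := (hdeg k).1
    simp [h] at this
  have he0 : ∀ k, e k ≠ 0 := fun k => by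
    rw [he, map_ne_zero_iff _ hι]
    intro h
    have := (hdeg k).2
    simp [h] at this
  have hτ0 : t 0 = τ := by rw [ht, hτ]; rfl
  have hA0 : α 0 = A := by rw [hα, hA]; rfl
  have htinv : Tendsto (fun k => (t k)⁻¹) atTop (𝓝 0) := by
    rw [ht]
    refine tendsto_inv_algebraMap_zero (tendsto_atTop_mono (fun k => ?_) tendsto_id)
    exact k.le_succ.trans (hdeg k).1
  have hαinv : Tendsto (fun k => (α k ^ 2)⁻¹) atTop (𝓝 0) := by
    rw [hα]
    simp only [← map_pow]
    exact tendsto_inv_algebraMap_zero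
      (tendsto_atTop_mono (le_natDegree_thueMorseRoots_fst_sq ha hb) tendsto_id)
  have htsucc : ∀ k, t (k + 1) = t k ^ 3 * e k := fun k => by
    simp only [ht, he, thueMorseRoots, map_mul, map_pow]
  have hαsucc : ∀ k, α (k + 1) = α k * t k ^ 2 * e k + t k * e k + 1 := fun k => by
    simp only [ht, he, hα, thueMorseRoots, map_mul, map_pow, map_add, map_one]
  have het : ∀ k, e k * τ = π * t k := fun k => by
    simp only [ht, he, hτ, hπ, ← map_mul, thueMorseRoots_two_mul]
  have hα0 : ∀ k, α k ≠ 0 := fun k => by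
    rw [hα, map_ne_zero_iff _ hι]
    intro h
    have := contMatrix_zero_zero_ne_zero (one_le_natDegree_thueMorse ha hb) (2 ^ (2 * k + 2))
    rw [contMatrix_thueMorse_eq_symMatrix] at this
    simp [symMatrix, h] at this
  obtain ⟨S, hS⟩ : ∃ S : ℕ → LaurentAtInfty K, S = fun k => ∑ j ∈ Finset.range k, (t j)⁻¹ :=
    ⟨_, rfl⟩
  have hSsucc : ∀ k, S (k + 1) = S k + (t k)⁻¹ := fun k => by
    simp only [hS, Finset.sum_range_succ]
  have hS0 : S 0 = 0 := by simp [hS]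
  obtain ⟨U, hU⟩ : ∃ U, Tendsto S atTop (𝓝 U) :=
    exists_tendsto_of_tendsto_sub_zero (htinv.congr fun k => by rw [hSsucc, add_sub_cancel_left])
  have hU' : Tendsto (fun k => S (k + 1)) atTop (𝓝 U) := hU.comp (tendsto_add_atTop_nat 1)
  have hτne : τ ≠ 0 := hτ0 ▸ ht0 0
  have hπne : π ≠ 0 := by
    intro h
    have := het 0
    simp [h, he0, hτne] at this
  -- Fourth powers are additive and send `1/τⱼ` to a multiple of `1/τⱼ₊₁`, so `S k ^ 4` gives `S (k
  -- + 1)` without its first term; that term accounts for the `+ 1`.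
  have hS4 : ∀ k, τ ^ 2 * S k ^ 4 = π * (τ * S (k + 1) + 1) := fun k => by
    induction k with
    | zero =>
      rw [hSsucc, hS0, hτ0]
      field_simp
      grind
    | succ k ih =>
      have key : τ * (t k)⁻¹ ^ 4 = π * (t (k + 1))⁻¹ := by
        have := ht0 k; have := he0 k; have := het k
        rw [htsucc]
        field_simp
        grind
      have hfrob : S (k + 1) ^ 4 = S k ^ 4 + (t k)⁻¹ ^ 4 := by
        rw [hSsucc]; grind
      rw [hfrob, hSsucc (k + 1)]
      linear_combination ih + τ * key
  have hα_eq : ∀ k, τ * α k * (t k)⁻¹ = A + 1 + τ * (S k ^ 2 + S (k + 1)) := fun k => by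
    induction k with
    | zero =>
      rw [hSsucc, hS0, hτ0, hA0]
      field_simp
      grind
    | succ k ih =>
      have := ht0 k; have := he0 k
      have key : α (k + 1) * (t (k + 1))⁻¹ = α k * (t k)⁻¹ + (t k)⁻¹ ^ 2 + (t (k + 1))⁻¹ := by
        rw [hαsucc, htsucc]
        field_simp
      have hfrob : S (k + 1) ^ 2 = S k ^ 2 + (t k)⁻¹ ^ 2 := by
        rw [hSsucc]; grind
      rw [hfrob, hSsucc (k + 1)]
      linear_combination ih + τ * key
  have hlim : Tendsto (fun k => t k * (α k)⁻¹) atTop (𝓝 (1 + f)) := by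
    rw [isContFracValue_iff (one_le_natDegree_thueMorse ha hb)] at hf
    have hmono : Tendsto (fun k : ℕ => 2 ^ (2 * k + 2)) atTop atTop :=
      tendsto_atTop_mono (fun k => (by
        have := (2 * k + 2).lt_two_pow_self
        simp only [id]; omega)) tendsto_id
    -- The convergent is `1/α² + 1 + τₖ/α`; in characteristic two this leaves `τₖ/α`.
    have h := ((hf.comp hmono).const_add 1).sub hαinv
    rw [sub_zero] at h
    refine h.congr fun k => ?_
    have := hα0 k
    simp only [Function.comp_apply, contMatrix_thueMorse_eq_symMatrix, symMatrix, Matrix.of_apply,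
      Matrix.cons_val', Matrix.cons_val_zero, Matrix.cons_val_one, Matrix.cons_val_fin_one,
      map_add, map_mul, map_pow, map_one]
    have hαk : polyToLaurent K (thueMorseRoots a b k).1 = α k := by rw [hα]
    have htk : polyToLaurent K (thueMorseRoots a b k).2.1 = t k := by rw [ht]
    rw [hαk, htk]
    field_simp
    grind
  refine ⟨τ * U, τ⁻¹ * (A + 1) + (U ^ 2 + U), ?_, ?_, ?_⟩
  · have h := tendsto_nhds_unique ((hU.pow 4).const_mul (τ ^ 2))
      ((((hU'.const_mul τ).add_const 1).const_mul π).congr fun k => (hS4 k).symm)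
    linear_combination τ ^ 2 * h
  · field_simp
    ring
  · have h : Tendsto (fun k => α k * (t k)⁻¹) atTop (𝓝 (τ⁻¹ * (A + 1) + (U ^ 2 + U))) := by
      refine (((hU.pow 2).add hU').const_add (τ⁻¹ * (A + 1))).congr fun k => ?_
      have h := hα_eq k
      have := ht0 k
      field_simp at h ⊢
      linear_combination -h
    refine tendsto_nhds_unique (h.mul hlim) (tendsto_const_nhds.congr fun k => ?_)
    have := hα0 k; have := ht0 k
    field_simp

end limits

/-! ### Degree and minimal polynomial. -/

section field

variable {F L : Type*} [Field F] [Field L] [Algebra F L]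

/-- The two generators determine each other, so they generate the same extension. -/
theorem adjoin_simple_eq_of_quadratic [CharP F 2] {y u f : L} {τ π A : F} (hτ : τ ≠ 0)
    (hπ : π ≠ τ) (hy : y ^ 4 = algebraMap F L π * algebraMap F L τ ^ 2 * (y + 1))
    (hu : algebraMap F L τ ^ 2 * u =
      y ^ 2 + algebraMap F L τ * y + algebraMap F L τ * (algebraMap F L A + 1))
    (hf : u * (1 + f) = 1) : IntermediateField.adjoin F {f} = IntermediateField.adjoin F {y} := by
  have : CharP L 2 := charP_of_injective_algebraMap (algebraMap F L).injective 2
  have h2 : (2 : L) = 0 := CharTwo.two_eq_zero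
  have hτ' : algebraMap F L τ ≠ 0 := by simpa using hτ
  have hπ' : algebraMap F L π - algebraMap F L τ ≠ 0 :=
    sub_ne_zero.mpr ((algebraMap F L).injective.ne hπ)
  have hu0 : u ≠ 0 := left_ne_zero_of_mul_eq_one hf
  have hf0 : 1 + f ≠ 0 := right_ne_zero_of_mul_eq_one hf
  apply le_antisymm
  · rw [IntermediateField.adjoin_simple_le_iff]
    have hy' := IntermediateField.mem_adjoin_simple_self F y
    have hu' : u ∈ IntermediateField.adjoin F {y} := by
      have : u = algebraMap F L (τ ^ 2)⁻¹ *
          (y ^ 2 + algebraMap F L τ * y + algebraMap F L (τ * (A + 1))) := by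
        simp only [map_mul, map_add, map_one, map_inv₀, map_pow]
        field_simp
        linear_combination hu
      rw [this]
      exact mul_mem (algebraMap_mem _ _) (add_mem (add_mem (pow_mem hy' 2)
        (mul_mem (algebraMap_mem _ _) hy')) (algebraMap_mem _ _))
    have : f = u⁻¹ - 1 := by
      field_simp
      linear_combination hf
    rw [this]
    exact sub_mem (inv_mem hu') (one_mem _)
  · rw [IntermediateField.adjoin_simple_le_iff]
    have hf' := IntermediateField.mem_adjoin_simple_self F f
    have hu' : u ∈ IntermediateField.adjoin F {f} := by
      rw [eq_inv_of_mul_eq_one_left hf]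
      exact inv_mem (add_mem (one_mem _) hf')
    -- In `(τ²u)² + τ⁴u` the `y⁴` term becomes affine in `y` and the `y²` terms cancel, leaving
    -- `τ²(π - τ) y` plus a constant.
    have : y = (algebraMap F L (τ ^ 2 * (π - τ)))⁻¹ *
        (algebraMap F L (τ ^ 4) * u ^ 2 + algebraMap F L (τ ^ 4) * u -
          algebraMap F L (τ ^ 2 * (A + 1) ^ 2 + τ ^ 3 * (A + 1) + π * τ ^ 2)) := by
      simp only [map_mul, map_add, map_sub, map_one, map_pow]
      have hu2 := congrArg (· ^ 2) hu
      rw [eq_inv_mul_iff_mul_eq₀ (mul_ne_zero (pow_ne_zero _ hτ') hπ')]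
      grind
    rw [this]
    exact mul_mem (inv_mem (algebraMap_mem _ _)) (sub_mem (add_mem
      (mul_mem (algebraMap_mem _ _) (pow_mem hu' 2)) (mul_mem (algebraMap_mem _ _) hu'))
      (algebraMap_mem _ _))

theorem natDegree_minpoly_eq_of_adjoin_eq {x y : L} (hy : IsIntegral F y)
    (h : IntermediateField.adjoin F {x} = IntermediateField.adjoin F {y}) :
    IsIntegral F x ∧ (minpoly F x).natDegree = (minpoly F y).natDegree := by
  have : FiniteDimensional F (IntermediateField.adjoin F {x}) := by
    rw [h]; exact IntermediateField.adjoin.finiteDimensional hy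
  have hx : IsIntegral F x := by
    have h1 : IsIntegral F (⟨x, IntermediateField.mem_adjoin_simple_self F x⟩ :
      IntermediateField.adjoin F {x}) := IsIntegral.of_finite F _
    exact h1.map (IntermediateField.adjoin F {x}).val
  exact ⟨hx, by rw [← IntermediateField.adjoin.finrank hx, ← IntermediateField.adjoin.finrank hy, h]⟩

/-- The degree bound forces the cofactor of the minimal polynomial to be constant. -/
theorem C_coeff_mul_minpoly {x : L} {q : F[X]} (hq : aeval x q = 0)
    (hdeg : q.natDegree ≤ (minpoly F x).natDegree) (hx : IsIntegral F x) :
    C (q.coeff (minpoly F x).natDegree) * minpoly F x = q := by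
  obtain ⟨r, hr⟩ := minpoly.dvd F x hq
  rcases eq_or_ne r 0 with rfl | hr0
  · simp [hr]
  have hm := minpoly.monic hx
  have h := hdeg
  rw [hr, natDegree_mul hm.ne_zero hr0] at h
  have hr1 : r = C (r.coeff 0) := eq_C_of_natDegree_eq_zero (by omega)
  have hcoeff : q.coeff (minpoly F x).natDegree = r.coeff 0 := by
    rw [hr, hr1, coeff_mul_C, hm.coeff_natDegree, one_mul, coeff_C_zero]
  rw [hcoeff, ← hr1, mul_comm, ← hr]

/-- By additivity of squaring, `1, u, u², u⁴` all lie in the span of `1, y, y²`, hence are linearly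
dependent. Multiplying that relation by `(1 + f)⁴` and expanding in characteristic two gives equal
coefficients at `f³` and `f`. -/
theorem quartic_eq_zero_of_root {R : Type*} [Field R] [CharP R 2] {y u f τ π A : R} (hτ : τ ≠ 0)
    (hy : y ^ 4 = π * τ ^ 2 * (y + 1)) (hu : τ ^ 2 * u = y ^ 2 + τ * y + τ * (A + 1))
    (hf : u * (1 + f) = 1) {p₀ p₁ p₂ p₄ : R}
    (h₁ : p₁ = π * (π + τ) * τ ^ 2) (h₂ : p₂ = p₁ + π * τ ^ 3)
    (h₄ : p₄ = (A + 1) ^ 4 + π * τ * (A + 1) ^ 2 + π * (π + τ) * τ * (A + 1) + π ^ 2 +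
      π * τ ^ 2 + π ^ 2 * τ) (h₀ : p₀ = τ ^ 4 + p₂ + p₄) :
    p₄ * f ^ 4 + p₁ * f ^ 3 + p₂ * f ^ 2 + p₁ * f + p₀ = 0 := by
  have h2 : (2 : R) = 0 := CharTwo.two_eq_zero
  have hsq : (τ ^ 2 * u) ^ 2 = π * τ ^ 2 * (y + 1) + τ ^ 2 * y ^ 2 + τ ^ 2 * (A + 1) ^ 2 := by
    rw [hu, ← hy, CharTwo.add_sq, CharTwo.add_sq]
    ring
  have hfourth : (τ ^ 2 * u) ^ 4 = π ^ 2 * τ ^ 4 * (y ^ 2 + 1) +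
      τ ^ 4 * (π * τ ^ 2 * (y + 1)) + τ ^ 4 * (A + 1) ^ 4 := by
    rw [← hy, show 4 = 2 * 2 from rfl, pow_mul, hsq, CharTwo.add_sq, CharTwo.add_sq, mul_pow _ (y + 1),
      CharTwo.add_sq y]
    ring
  have hlin : τ ^ 4 * (τ ^ 4 * u ^ 4 + π * τ ^ 3 * u ^ 2 + p₁ * u + p₄) = 0 := by
    have : τ ^ 4 * (τ ^ 4 * u ^ 4 + π * τ ^ 3 * u ^ 2 + p₁ * u + p₄) = (τ ^ 2 * u) ^ 4 +
      π * τ ^ 3 * (τ ^ 2 * u) ^ 2 + p₁ * τ ^ 2 * (τ ^ 2 * u) + τ ^ 4 * p₄ := by ring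
    rw [this, hfourth, hsq, hu, h₁, h₄]
    clear * - h2
    grind
  have hlin' := (mul_eq_zero.mp hlin).resolve_left (pow_ne_zero _ hτ)
  have hmul : τ ^ 4 + π * τ ^ 3 * (1 + f) ^ 2 + p₁ * (1 + f) ^ 3 + p₄ * (1 + f) ^ 4 = 0 := by
    have e2 : u ^ 2 * (1 + f) ^ 2 = 1 := by rw [← mul_pow, hf, one_pow]
    have e4 : u ^ 4 * (1 + f) ^ 4 = 1 := by rw [← mul_pow, hf, one_pow]
    linear_combination (1 + f) ^ 4 * hlin' - τ ^ 4 * e4 - π * τ ^ 3 * (1 + f) ^ 2 * e2 -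
      p₁ * (1 + f) ^ 3 * hf
  rw [h₀, h₂]
  clear * - h2 hmul
  grind

end field

/-- Eisenstein's criterion at `X` for `y⁴ + c y + c`. -/
theorem irreducible_quartic_of_dvd {K : Type*} [Field K] {c : K[X]} (h0 : c.coeff 0 = 0)
    (h1 : c.coeff 1 ≠ 0) :
    Irreducible (X ^ 4 + C (algebraMap K[X] (RatFunc K) c) * X + C (algebraMap K[X] (RatFunc K) c) :
      (RatFunc K)[X]) := by
  have hmonic : (X ^ 4 + C c * X + C c : K[X][X]).Monic := by monicity!
  have hdeg : (X ^ 4 + C c * X + C c : K[X][X]).natDegree = 4 := by compute_degree!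
  have hE : (X ^ 4 + C c * X + C c : K[X][X]).IsEisensteinAt (Ideal.span {(X : K[X])}) := by
    refine ⟨?_, fun {n} hn => ?_, ?_⟩
    · rw [hmonic.leadingCoeff, Ideal.mem_span_singleton]
      exact fun h => not_isUnit_X (isUnit_of_dvd_one h)
    · rw [hdeg] at hn
      rw [Ideal.mem_span_singleton, X_dvd_iff]
      interval_cases n <;> simp [coeff_X, h0, coeff_X_pow, coeff_C]
    · rw [Ideal.span_singleton_pow, Ideal.mem_span_singleton]
      intro h
      rw [X_pow_dvd_iff] at h
      apply h1
      simpa using h 1 one_lt_two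
  have hirr := hE.irreducible ((Ideal.span_singleton_prime X_ne_zero).mpr prime_X)
    hmonic.isPrimitive (by rw [hdeg]; norm_num)
  have := (hmonic.irreducible_iff_irreducible_map_fraction_map (K := RatFunc K)).mp hirr
  simpa using this

/-- The conditions on coefficients 0 and 1 are Eisenstein at `z` for `πτ²`, and `a ≠ b` amounts to
`π ≠ τ`. The formula for `p₄` keeps `A + 1` unsimplified, with `A = ab + a + 1` the initial `α`. -/
theorem exists_isContFracValue_thueMorse {K : Type*} [Field K] [CharP K 2] {a b : K[X]}
    (ha : 1 ≤ a.natDegree) (hb : 1 ≤ b.natDegree) (hab : a ≠ b)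
    (h0 : (a * b * (a * b + a + b) ^ 2).coeff 0 = 0)
    (h1 : (a * b * (a * b + a + b) ^ 2).coeff 1 ≠ 0) {p₀ p₁ p₂ p₄ : K[X]}
    (hp₁ : p₁ = a * b * (a * b + (a * b + a + b)) * (a * b + a + b) ^ 2)
    (hp₂ : p₂ = p₁ + a * b * (a * b + a + b) ^ 3)
    (hp₄ : p₄ = (a * b + a + 1 + 1) ^ 4 + a * b * (a * b + a + b) * (a * b + a + 1 + 1) ^ 2 +
      a * b * (a * b + (a * b + a + b)) * (a * b + a + b) * (a * b + a + 1 + 1) + (a * b) ^ 2 +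
      a * b * (a * b + a + b) ^ 2 + (a * b) ^ 2 * (a * b + a + b))
    (hp₀ : p₀ = (a * b + a + b) ^ 4 + p₂ + p₄) :
    ∃ f : LaurentAtInfty K, IsContFracValue (thueMorse a b) f ∧
      IsAlgebraic (RatFunc K) f ∧ (minpoly (RatFunc K) f).natDegree = 4 ∧
      C (algebraMap K[X] (RatFunc K) p₄) * minpoly (RatFunc K) f = quartic p₀ p₁ p₂ p₁ p₄ := by
  obtain ⟨f, hf⟩ := exists_isContFracValue (one_le_natDegree_thueMorse ha hb)
  have hτ : a * b + a + b ≠ 0 := by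
    intro h
    have := natDegree_mul_add_add ha hb
    rw [h, natDegree_zero] at this
    omega
  have hπ : a * b ≠ a * b + a + b := by
    intro h
    exact hab (CharTwo.add_eq_zero.mp (by linear_combination -h))
  obtain ⟨y, u, hy, hu, huf⟩ := exists_quartic_root_of_isContFracValue ha hb hf rfl rfl rfl
  have hyroot : aeval y (X ^ 4 + C (algebraMap K[X] (RatFunc K) (a * b * (a * b + a + b) ^ 2)) * X +
      C (algebraMap K[X] (RatFunc K) (a * b * (a * b + a + b) ^ 2))) = 0 := by
    have h2 : (2 : LaurentAtInfty K) = 0 := CharTwo.two_eq_zero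
    simp only [map_add, map_mul, map_pow, aeval_X, aeval_C, RingHom.comp_apply] at hy ⊢
    rw [hy]
    grind
  have hmonic : (X ^ 4 + C (algebraMap K[X] (RatFunc K) (a * b * (a * b + a + b) ^ 2)) * X +
      C (algebraMap K[X] (RatFunc K) (a * b * (a * b + a + b) ^ 2)) : (RatFunc K)[X]).Monic := by
    monicity!
  have hymin := minpoly.eq_of_irreducible_of_monic (irreducible_quartic_of_dvd h0 h1) hyroot hmonic
  have hydeg : (minpoly (RatFunc K) y).natDegree = 4 := by
    rw [← hymin]
    compute_degree!
  have hyint : IsIntegral (RatFunc K) y := ⟨_, hmonic, hyroot⟩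
  have : CharP (RatFunc K) 2 :=
    charP_of_injective_algebraMap (algebraMap K (RatFunc K)).injective 2
  have hinj := RatFunc.algebraMap_injective K
  have hadj := adjoin_simple_eq_of_quadratic ((map_ne_zero_iff _ hinj).mpr hτ) (hinj.ne hπ)
    hy (A := algebraMap K[X] (RatFunc K) (a * b + a + 1)) hu huf
  obtain ⟨hfint, hfdeg⟩ := natDegree_minpoly_eq_of_adjoin_eq hyint hadj
  rw [hydeg] at hfdeg
  refine ⟨f, hf, hfint.isAlgebraic, hfdeg, ?_⟩
  have hroot : aeval f (quartic p₀ p₁ p₂ p₁ p₄) = 0 := by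
    have := quartic_eq_zero_of_root
      ((map_ne_zero_iff _ (polyToLaurent_injective K)).mpr hτ) hy hu huf
      (p₀ := polyToLaurent K p₀) (p₁ := polyToLaurent K p₁) (p₂ := polyToLaurent K p₂)
      (p₄ := polyToLaurent K p₄) (by rw [hp₁]; simp only [map_add, map_mul, map_pow])
      (by rw [hp₂]; simp only [map_add, map_mul, map_pow])
      (by rw [hp₄]; simp only [map_add, map_mul, map_pow, map_one])
      (by rw [hp₀]; simp only [map_add, map_pow])
    simpa [quartic] using this
  have hq : (quartic p₀ p₁ p₂ p₁ p₄).natDegree ≤ 4 := by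
    simp only [quartic, Polynomial.map_add, Polynomial.map_mul, Polynomial.map_pow, map_C, map_X]
    compute_degree
  have hcoeff : (quartic p₀ p₁ p₂ p₁ p₄).coeff 4 = algebraMap K[X] (RatFunc K) p₄ := by
    rw [quartic, coeff_map]
    simp
  have := C_coeff_mul_minpoly hroot (hq.trans_eq hfdeg.symm) hfint
  rwa [hfdeg, hcoeff] at this

/-! ### The pair `z`, `z² + z + 1`. -/

theorem thueMorse_quartic_coeffs {R : Type*} [CommRing R] [CharP R 2] {x a b p₀ p₁ p₂ p₄ : R}
    (ha : a = x) (hb : b = x ^ 2 + x + 1)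
    (hp₀ : p₀ = x ^ 9 + x ^ 7 + x ^ 6 + x ^ 5 + x ^ 4 + x + 1)
    (hp₁ : p₁ = x ^ 11 + x ^ 10 + x ^ 8 + x ^ 6 + x ^ 5 + x ^ 3 + x ^ 2 + x)
    (hp₂ : p₂ = x ^ 12 + x ^ 10 + x ^ 2)
    (hp₄ : p₄ = x ^ 10 + x ^ 9 + x ^ 7 + x ^ 6 + x ^ 5 + x ^ 2 + x) :
    p₁ = a * b * (a * b + (a * b + a + b)) * (a * b + a + b) ^ 2 ∧
      p₂ = p₁ + a * b * (a * b + a + b) ^ 3 ∧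
      p₄ = (a * b + a + 1 + 1) ^ 4 + a * b * (a * b + a + b) * (a * b + a + 1 + 1) ^ 2 +
        a * b * (a * b + (a * b + a + b)) * (a * b + a + b) * (a * b + a + 1 + 1) + (a * b) ^ 2 +
        a * b * (a * b + a + b) ^ 2 + (a * b) ^ 2 * (a * b + a + b) ∧
      p₀ = (a * b + a + b) ^ 4 + p₂ + p₄ := by
  have h2 : (2 : R) = 0 := CharTwo.two_eq_zero
  subst ha hb hp₀ hp₁ hp₂ hp₄
  refine ⟨?_, ?_, ?_, ?_⟩ <;> grind

theorem thueMorse_swap_quartic_coeffs {R : Type*} [CommRing R] [CharP R 2] {x a b p₀ p₁ p₂ p₄ : R}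
    (ha : a = x ^ 2 + x + 1) (hb : b = x)
    (hp₀ : p₀ = x ^ 9 + x ^ 8 + x ^ 7 + x ^ 6 + x ^ 5 + x ^ 4 + x)
    (hp₁ : p₁ = x ^ 11 + x ^ 10 + x ^ 8 + x ^ 6 + x ^ 5 + x ^ 3 + x ^ 2 + x)
    (hp₂ : p₂ = x ^ 12 + x ^ 10 + x ^ 2)
    (hp₄ : p₄ = x ^ 10 + x ^ 9 + x ^ 8 + x ^ 7 + x ^ 6 + x ^ 5 + x ^ 2 + x + 1) :
    p₁ = a * b * (a * b + (a * b + a + b)) * (a * b + a + b) ^ 2 ∧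
      p₂ = p₁ + a * b * (a * b + a + b) ^ 3 ∧
      p₄ = (a * b + a + 1 + 1) ^ 4 + a * b * (a * b + a + b) * (a * b + a + 1 + 1) ^ 2 +
        a * b * (a * b + (a * b + a + b)) * (a * b + a + b) * (a * b + a + 1 + 1) + (a * b) ^ 2 +
        a * b * (a * b + a + b) ^ 2 + (a * b) ^ 2 * (a * b + a + b) ∧
      p₀ = (a * b + a + b) ^ 4 + p₂ + p₄ := by
  have h2 : (2 : R) = 0 := CharTwo.two_eq_zero
  subst ha hb hp₀ hp₁ hp₂ hp₄
  refine ⟨?_, ?_, ?_, ?_⟩ <;> grind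

theorem X_and_X_sq_add_X_add_one {K : Type*} [Field K] {a b : K[X]} (ha : a = X)
    (hb : b = X ^ 2 + X + 1) : 1 ≤ a.natDegree ∧ 1 ≤ b.natDegree ∧ a ≠ b ∧
      (a * b * (a * b + a + b) ^ 2).coeff 0 = 0 ∧ (a * b * (a * b + a + b) ^ 2).coeff 1 ≠ 0 := by
  have hda : a.natDegree = 1 := by rw [ha, natDegree_X]
  have hdb : b.natDegree = 2 := by rw [hb]; compute_degree!
  refine ⟨hda.ge, by omega, by rintro rfl; omega, by simp [ha, mul_coeff_zero], ?_⟩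
  -- Removing the factor `z` leaves `bτ²`, whose constant term is 1.
  rw [ha, hb, mul_assoc, coeff_X_mul]
  simp [coeff_zero_eq_eval_zero]

/-- Let `a = z`, `b = z² + z + 1` in `𝔽₂[z]`. The continued fractions of the `(a, b)`- and the
`(b, a)`-Thue–Morse sequences converge in `𝔽₂((1/z))`, to elements `f` and `g` that are algebraic
of degree `4` over `𝔽₂(z)`; their minimal polynomials are the displayed quartics, up to division
by the leading coefficient. -/
theorem theorem1 (a b : (ZMod 2)[X]) (ha : a = X) (hb : b = X ^ 2 + X + 1) :
    ∃ f g : LaurentAtInfty (ZMod 2),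
      IsContFracValue (thueMorse a b) f ∧
      IsContFracValue (thueMorse b a) g ∧
      IsAlgebraic (RatFunc (ZMod 2)) f ∧
      IsAlgebraic (RatFunc (ZMod 2)) g ∧
      (minpoly (RatFunc (ZMod 2)) f).natDegree = 4 ∧
      (minpoly (RatFunc (ZMod 2)) g).natDegree = 4 ∧
      C (algebraMap (ZMod 2)[X] (RatFunc (ZMod 2))
          (X ^ 10 + X ^ 9 + X ^ 7 + X ^ 6 + X ^ 5 + X ^ 2 + X)) *
        minpoly (RatFunc (ZMod 2)) f =
      quartic
        (X ^ 9 + X ^ 7 + X ^ 6 + X ^ 5 + X ^ 4 + X + 1)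
        (X ^ 11 + X ^ 10 + X ^ 8 + X ^ 6 + X ^ 5 + X ^ 3 + X ^ 2 + X)
        (X ^ 12 + X ^ 10 + X ^ 2)
        (X ^ 11 + X ^ 10 + X ^ 8 + X ^ 6 + X ^ 5 + X ^ 3 + X ^ 2 + X)
        (X ^ 10 + X ^ 9 + X ^ 7 + X ^ 6 + X ^ 5 + X ^ 2 + X) ∧
      C (algebraMap (ZMod 2)[X] (RatFunc (ZMod 2))
          (X ^ 10 + X ^ 9 + X ^ 8 + X ^ 7 + X ^ 6 + X ^ 5 + X ^ 2 + X + 1)) *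
        minpoly (RatFunc (ZMod 2)) g =
      quartic
        (X ^ 9 + X ^ 8 + X ^ 7 + X ^ 6 + X ^ 5 + X ^ 4 + X)
        (X ^ 11 + X ^ 10 + X ^ 8 + X ^ 6 + X ^ 5 + X ^ 3 + X ^ 2 + X)
        (X ^ 12 + X ^ 10 + X ^ 2)
        (X ^ 11 + X ^ 10 + X ^ 8 + X ^ 6 + X ^ 5 + X ^ 3 + X ^ 2 + X)
        (X ^ 10 + X ^ 9 + X ^ 8 + X ^ 7 + X ^ 6 + X ^ 5 + X ^ 2 + X + 1) := by
  obtain ⟨hda, hdb, hab, h0, h1⟩ := X_and_X_sq_add_X_add_one ha hb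
  obtain ⟨e₁, e₂, e₄, e₀⟩ := thueMorse_quartic_coeffs ha hb rfl rfl rfl rfl
  obtain ⟨d₁, d₂, d₄, d₀⟩ := thueMorse_swap_quartic_coeffs hb ha rfl rfl rfl rfl
  obtain ⟨f, hf, hf1, hf2, hf3⟩ :=
    exists_isContFracValue_thueMorse hda hdb hab h0 h1 e₁ e₂ e₄ e₀
  -- `πτ²` is symmetric in `a` and `b`, so the same Eisenstein conditions serve the swapped
  -- sequence.
  rw [mul_comm a b, add_right_comm] at h0 h1
  obtain ⟨g, hg, hg1, hg2, hg3⟩ :=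
    exists_isContFracValue_thueMorse hdb hda hab.symm h0 h1 d₁ d₂ d₄ d₀
  exact ⟨f, g, hf, hg, hf1, hg1, hf2, hg2, hf3, hg3⟩
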